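/- Let $d\ge 1$, let $G$ be a measure on $(0,+\infty)$ whose tail function $\bar G(u)=G((u,+\infty))$ is finite for every $u>0$, let $h:\mathbb R^d\to[0,+\infty]$ be measurable, and let $\Phi$ be a Poisson point process on $\mathbb R^d\times(0,+\infty)$ with intensity $dx\,G(dm)$, defined on a probability space and viewed as a random locally finite set. The extremal shot noise $M$ is the random field $$M(y)=\sup\{m\,h(y-x)\;;\;(x,m)\in\Phi\}\in[0,+\infty],\qquad y\in\mathbb R^d .$$ For measurable $f:\mathbb R^d\to[0,+\infty]$ put $$\alpha(f,G)=\inf\Big\{u>0\;;\;\int_{\mathbb R^d}\bar G\big(u/f(x)\big)\,dx<+\infty\Big\},$$ with $\inf\emptyset=+\infty$, where $\bar G(u/f(x))=0$ if $f(x)=0$ and $\bar G(u/f(x))=G((0,+\infty))$ if $f(x)=+\infty$. Let $\alpha^+(h,G)=\alpha(h^+,G)$ with $h^+(x)=\sup\{h(x+z);|z|\le 1\}$, and $\alpha^-(h,G)=\lim_{\varepsilon\to0^+}\alpha(h^-_\varepsilon,G)$ with $h^-_\varepsilon(x)=\inf\{h(x+z);|z|\le\varepsilon\}$. Then: 1.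 If $h$ is lower semicontinuous, then $M$ is lower semicontinuous (for every realization of $\Phi$). 2. If $\alpha^-(h,G)=\alpha^+(h,G)$ and $h$ is upper semicontinuous, then $M$ is almost surely upper semicontinuous. 3. If $\alpha^-(h,G)=\alpha^+(h,G)$ and $h$ is continuous, then $M$ is almost surely continuous (as a $[0,+\infty]$-valued function). -/

import Mathlib

open MeasureTheory ProbabilityTheory Filter Topology
open scoped ENNReal

noncomputable section

/-- `Φ` is a Poisson point process on `E` with intensity measure `μ`, defined on `(Ω, P)`: a random
locally finite subset of `E` whose counts on Borel sets are random variables with values in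
`ℕ ∪ {∞}`, are Poisson distributed with parameter `μ A` when `μ A < ∞`, and are independent on
disjoint sets. -/
structure IsPoissonPointProcess {Ω E : Type*} [MeasurableSpace Ω] [TopologicalSpace E]
    [MeasurableSpace E] (P : Measure Ω) (μ : Measure E) (Φ : Ω → Set E) : Prop where
  finite_inter_compact : ∀ ω, ∀ K : Set E, IsCompact K → (Φ ω ∩ K).Finite
  measurable_count : ∀ A : Set E, MeasurableSet A → Measurable fun ω => (Φ ω ∩ A).encard
  poisson_count : ∀ A : Set E, MeasurableSet A → μ A < ∞ →
    HasLaw (fun ω => (Φ ω ∩ A).encard)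
      ((poissonMeasure (μ A).toNNReal).map (Nat.cast : ℕ → ℕ∞)) P
  indep_count : ∀ (n : ℕ) (A : Fin n → Set E), (∀ i, MeasurableSet (A i)) →
    Pairwise (fun i j => Disjoint (A i) (A j)) →
    iIndepFun (fun i ω => (Φ ω ∩ A i).encard) P

/-- The tail function `u ↦ G((u, ∞))` on `[0, ∞]` of a measure `G` on `(0, ∞)`. -/
def tailFun (G : Measure (Set.Ioi (0 : ℝ))) (u : ℝ≥0∞) : ℝ≥0∞ :=
  G {m | u < ENNReal.ofReal (m : ℝ)}

/-- The coefficient `α(h, G) = inf {u > 0 : ∫ Ḡ(u / h(x)) dx < ∞}`, with `inf ∅ = ∞`. For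
`0 < u < ∞` the division of `[0, ∞]` gives `u / 0 = ∞`, with tail `0`, and `u / ∞ = 0`, with tail
`G((0, ∞))`. -/
def alphaCoeff {d : ℕ} (h : EuclideanSpace ℝ (Fin d) → ℝ≥0∞)
    (G : Measure (Set.Ioi (0 : ℝ))) : ℝ≥0∞ :=
  sInf {u : ℝ≥0∞ | 0 < u ∧ u < ∞ ∧ ∫⁻ x, tailFun G (u / h x) < ∞}

/-- `h⁺(x) = sup {h(x + z) : |z| ≤ 1}`. -/
def upperEnv {d : ℕ} (h : EuclideanSpace ℝ (Fin d) → ℝ≥0∞) (x : EuclideanSpace ℝ (Fin d)) :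
    ℝ≥0∞ :=
  ⨆ z : EuclideanSpace ℝ (Fin d), ⨆ _ : ‖z‖ ≤ 1, h (x + z)

/-- `h⁻_ε(x) = inf {h(x + z) : |z| ≤ ε}`. -/
def lowerEnv {d : ℕ} (ε : ℝ) (h : EuclideanSpace ℝ (Fin d) → ℝ≥0∞)
    (x : EuclideanSpace ℝ (Fin d)) : ℝ≥0∞ :=
  ⨅ z : EuclideanSpace ℝ (Fin d), ⨅ _ : ‖z‖ ≤ ε, h (x + z)

/-- `α⁺(h, G) = α(h⁺, G)`. -/
def alphaPlus {d : ℕ} (h : EuclideanSpace ℝ (Fin d) → ℝ≥0∞)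
    (G : Measure (Set.Ioi (0 : ℝ))) : ℝ≥0∞ :=
  alphaCoeff (upperEnv h) G

/-- `α⁻(h, G) = lim_{ε → 0, ε > 0} α(h⁻_ε, G)`; the limit exists, see `tendsto_alphaMinus`. -/
def alphaMinus {d : ℕ} (h : EuclideanSpace ℝ (Fin d) → ℝ≥0∞)
    (G : Measure (Set.Ioi (0 : ℝ))) : ℝ≥0∞ :=
  limUnder (𝓝[>] (0 : ℝ)) fun ε => alphaCoeff (lowerEnv ε h) G

theorem alphaCoeff_mono {d : ℕ} {h h' : EuclideanSpace ℝ (Fin d) → ℝ≥0∞} (hle : h ≤ h')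
    (G : Measure (Set.Ioi (0 : ℝ))) : alphaCoeff h G ≤ alphaCoeff h' G := by
  refine sInf_le_sInf ?_
  rintro u ⟨h0, h1, h2⟩
  refine ⟨h0, h1, lt_of_le_of_lt (lintegral_mono fun x => measure_mono ?_) h2⟩
  intro m hm
  exact lt_of_le_of_lt (ENNReal.div_le_div_left (hle x) u) hm

theorem tendsto_alphaMinus {d : ℕ} (h : EuclideanSpace ℝ (Fin d) → ℝ≥0∞)
    (G : Measure (Set.Ioi (0 : ℝ))) :
    Tendsto (fun ε => alphaCoeff (lowerEnv ε h) G) (𝓝[>] (0 : ℝ)) (𝓝 (alphaMinus h G)) := by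
  have hanti : Antitone fun ε : ℝ => alphaCoeff (lowerEnv ε h) G := by
    intro ε ε' hε
    refine alphaCoeff_mono (fun x => ?_) G
    exact iInf_mono fun z => le_iInf fun hz => iInf_le_of_le (hz.trans hε) le_rfl
  exact tendsto_nhds_limUnder ⟨_, hanti.tendsto_nhdsGT 0⟩

/-- The extremal shot noise `M(y) = sup {m h(y - x) : (x, m) ∈ Φ}` of a set `Φ` of points of
`ℝ^d × (0, ∞)`, with values in `[0, ∞]`. -/
def extremalShotNoise {d : ℕ} (h : EuclideanSpace ℝ (Fin d) → ℝ≥0∞)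
    (Φ : Set (EuclideanSpace ℝ (Fin d) × Set.Ioi (0 : ℝ))) (y : EuclideanSpace ℝ (Fin d)) :
    ℝ≥0∞ :=
  ⨆ φ ∈ Φ, ENNReal.ofReal (φ.2 : ℝ) * h (y - φ.1)

end

/-! Lower semicontinuity is deterministic: `M` is a supremum of lower semicontinuous functions.
Upper semicontinuity rests on a dichotomy at level `u`: the mean number of points with `m f(y - x) >
u` is `∫ Ḡ(u / f)`. With `f = h⁻_ε` it is infinite for `0 < u < α⁻` and small `ε`, so almost surely
`M ≥ α⁻` everywhere (`ae_alphaMinus_le_extremalShotNoise`). With `f = h⁺` it is finite for `α⁺ < u <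
∞`, so near each location only finitely many points exceed `u` (`ae_finite_exceedances`). If `M(y) <
c` and `α⁻ = α⁺`, any `u` strictly between `M(y)` and `c` is above `α⁺`, and near `y` only finitely
many upper semicontinuous terms matter. -/

/-- A Poisson point process has almost surely finitely many points in a set of finite intensity. -/
theorem IsPoissonPointProcess.ae_finite_inter {Ω E : Type*} [MeasurableSpace Ω]
    [TopologicalSpace E] [MeasurableSpace E] {P : Measure Ω} {μ : Measure E} {Φ : Ω → Set E}
    (hΦ : IsPoissonPointProcess P μ Φ) {A : Set E} (hA : MeasurableSet A) (hμ : μ A < ∞) :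
    ∀ᵐ ω ∂P, (Φ ω ∩ A).Finite := by
  have hlaw := (hΦ.poisson_count A hA hμ).measure_eq (p := fun n => n = ⊤) .of_discrete
  rw [Measure.map_apply .of_discrete .of_discrete] at hlaw
  have hpre : (Nat.cast : ℕ → ℕ∞) ⁻¹' {n | n = ⊤} = ∅ := by ext; simp
  rw [hpre, measure_empty] at hlaw
  rw [ae_iff, ← hlaw]
  congr 1
  ext ω
  exact Set.encard_eq_top_iff.symm

theorem IsPoissonPointProcess.measure_inter_eq_empty {Ω E : Type*} [MeasurableSpace Ω]
    [TopologicalSpace E] [MeasurableSpace E] {P : Measure Ω} {μ : Measure E} {Φ : Ω → Set E}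
    (hΦ : IsPoissonPointProcess P μ Φ) {A : Set E} (hA : MeasurableSet A) (hμ : μ A < ∞) :
    P {ω | Φ ω ∩ A = ∅} = ENNReal.ofReal (Real.exp (-(μ A).toReal)) := by
  have hlaw := (hΦ.poisson_count A hA hμ).measure_eq (p := fun n => n = 0) .of_discrete
  rw [Measure.map_apply .of_discrete .of_discrete] at hlaw
  have hpre : (Nat.cast : ℕ → ℕ∞) ⁻¹' {n | n = 0} = {0} := by ext; simp
  rw [hpre, poissonMeasure_singleton] at hlaw
  simpa [Set.encard_eq_zero, ENNReal.coe_toNNReal_eq_toReal] using hlaw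

/-- A Poisson point process almost surely hits a set of infinite intensity. -/
theorem IsPoissonPointProcess.ae_nonempty_inter {Ω E : Type*} [MeasurableSpace Ω]
    [TopologicalSpace E] [MeasurableSpace E] {P : Measure Ω} {μ : Measure E} [SigmaFinite μ]
    {Φ : Ω → Set E} (hΦ : IsPoissonPointProcess P μ Φ) {A : Set E} (hA : MeasurableSet A)
    (hμ : μ A = ∞) : ∀ᵐ ω ∂P, (Φ ω ∩ A).Nonempty := by
  have hle : ∀ n : ℕ, P {ω | ¬ (Φ ω ∩ A).Nonempty} ≤ ENNReal.ofReal (Real.exp (-(n : ℝ))) := by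
    intro n
    -- The Poisson law is only prescribed on finite intensity, so `A` is replaced by subsets of
    -- arbitrarily large finite intensity.
    obtain ⟨B, hB, hBA, hnB, hBfin⟩ := Measure.exists_subset_measure_lt_top hA
      (show (n : ℝ≥0∞) < μ A by simp [hμ])
    calc P {ω | ¬ (Φ ω ∩ A).Nonempty} ≤ P {ω | Φ ω ∩ B = ∅} := by
          refine measure_mono fun ω hω => ?_
          rw [Set.mem_ofPred_eq, Set.not_nonempty_iff_eq_empty] at hω
          exact Set.subset_empty_iff.1 (hω ▸ Set.inter_subset_inter_right _ hBA)
      _ = ENNReal.ofReal (Real.exp (-(μ B).toReal)) := hΦ.measure_inter_eq_empty hB hBfin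
      _ ≤ ENNReal.ofReal (Real.exp (-(n : ℝ))) := by
          have : (n : ℝ) ≤ (μ B).toReal := by
            simpa using ENNReal.toReal_mono hBfin.ne hnB.le
          gcongr
  have hlim : Tendsto (fun n : ℕ => ENNReal.ofReal (Real.exp (-(n : ℝ)))) atTop (𝓝 0) := by
    have := ENNReal.tendsto_ofReal
      (Real.tendsto_exp_neg_atTop_nhds_zero.comp tendsto_natCast_atTop_atTop)
    simpa using this
  exact ae_iff.2 (le_antisymm (ge_of_tendsto' hlim hle) zero_le)

theorem sigmaFinite_of_tail_lt_top {G : Measure (Set.Ioi (0 : ℝ))}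
    (hG : ∀ u : ℝ, 0 < u → G {m | u < (m : ℝ)} < ∞) : SigmaFinite G := by
  refine ⟨⟨⟨fun n => {m | 1 / ((n : ℝ) + 1) < (m : ℝ)}, fun _ => trivial,
    fun n => hG _ (by positivity), ?_⟩⟩⟩
  refine Set.eq_univ_of_forall fun m => Set.mem_iUnion.2 ?_
  exact exists_nat_one_div_lt (Set.mem_Ioi.1 m.2)

/-- The points whose translated profile `f (y - ·)`, scaled by the mark, exceeds `u`. -/
def exceedanceSet {d : ℕ} (f : EuclideanSpace ℝ (Fin d) → ℝ≥0∞) (u : ℝ≥0∞)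
    (y : EuclideanSpace ℝ (Fin d)) : Set (EuclideanSpace ℝ (Fin d) × Set.Ioi (0 : ℝ)) :=
  {φ | u < ENNReal.ofReal (φ.2 : ℝ) * f (y - φ.1)}

theorem measurableSet_exceedanceSet {d : ℕ} {f : EuclideanSpace ℝ (Fin d) → ℝ≥0∞}
    (hf : Measurable f) (u : ℝ≥0∞) (y : EuclideanSpace ℝ (Fin d)) :
    MeasurableSet (exceedanceSet f u y) := by
  refine measurableSet_lt measurable_const (.mul ?_ ?_)
  · exact ENNReal.measurable_ofReal.comp (measurable_subtype_coe.comp measurable_snd)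
  · exact hf.comp (measurable_const.sub measurable_fst)

/-- Lebesgue measure is invariant under `x ↦ y - x`, so the location `y` drops out. -/
theorem prod_exceedanceSet {d : ℕ} {G : Measure (Set.Ioi (0 : ℝ))} [SFinite G]
    {f : EuclideanSpace ℝ (Fin d) → ℝ≥0∞} (hf : Measurable f) {u : ℝ≥0∞} (hu0 : u ≠ 0)
    (hu : u ≠ ∞) (y : EuclideanSpace ℝ (Fin d)) :
    ((volume : Measure (EuclideanSpace ℝ (Fin d))).prod G) (exceedanceSet f u y) =
      ∫⁻ x, tailFun G (u / f x) := by
  rw [Measure.prod_apply (measurableSet_exceedanceSet hf u y),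
    ← lintegral_sub_left_eq_self (fun x => tailFun G (u / f x)) y]
  refine lintegral_congr fun x => ?_
  congr 1
  ext m
  exact (ENNReal.div_lt_iff (.inr hu0) (.inr hu)).symm

theorem lintegral_tailFun_lt_top_of_alphaCoeff_lt {d : ℕ}
    {f : EuclideanSpace ℝ (Fin d) → ℝ≥0∞} {G : Measure (Set.Ioi (0 : ℝ))} {u : ℝ≥0∞}
    (hu : alphaCoeff f G < u) : ∫⁻ x, tailFun G (u / f x) < ∞ := by
  obtain ⟨v, ⟨-, -, hv⟩, hvu⟩ := sInf_lt_iff.1 hu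
  refine lt_of_le_of_lt (lintegral_mono fun x => measure_mono fun m hm => ?_) hv
  exact lt_of_le_of_lt (ENNReal.div_le_div_right hvu.le _) hm

theorem lintegral_tailFun_eq_top_of_lt_alphaCoeff {d : ℕ}
    {f : EuclideanSpace ℝ (Fin d) → ℝ≥0∞} {G : Measure (Set.Ioi (0 : ℝ))} {u : ℝ≥0∞}
    (hu0 : 0 < u) (hu : u < alphaCoeff f G) : ∫⁻ x, tailFun G (u / f x) = ∞ := by
  by_contra hne
  exact notMem_of_lt_csInf' hu ⟨hu0, hu.trans_le le_top, lt_top_iff_ne_top.2 hne⟩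

theorem le_upperEnv {d : ℕ} (h : EuclideanSpace ℝ (Fin d) → ℝ≥0∞)
    {x x' : EuclideanSpace ℝ (Fin d)} (hx : dist x' x ≤ 1) : h x' ≤ upperEnv h x := by
  refine le_trans (by simp) (le_iSup₂ (f := fun z (_ : ‖z‖ ≤ 1) => h (x + z)) (x' - x) ?_)
  rwa [← dist_eq_norm]

/-- By compactness, a bound `h < c` on a closed unit ball persists on a thickening, which contains
the nearby unit balls. The maximum there is attained, which keeps the inequality strict. -/
theorem upperSemicontinuous_upperEnv {d : ℕ} {h : EuclideanSpace ℝ (Fin d) → ℝ≥0∞}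
    (hh : UpperSemicontinuous h) : UpperSemicontinuous (upperEnv h) := by
  intro x c hc
  have hsub : Metric.closedBall x 1 ⊆ h ⁻¹' Set.Iio c :=
    fun w hw => lt_of_le_of_lt (le_upperEnv h hw) hc
  obtain ⟨δ, hδ, hδsub⟩ := (isCompact_closedBall x 1).exists_thickening_subset_open
    (hh.isOpen_preimage c) hsub
  filter_upwards [Metric.ball_mem_nhds x hδ] with x' hx'
  obtain ⟨w, hw, hmax⟩ := (hh.upperSemicontinuousOn (Metric.closedBall x' 1)).exists_isMaxOn
    (Metric.nonempty_closedBall.2 zero_le_one) (isCompact_closedBall x' 1)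
  have hwc : h w < c := by
    refine hδsub (Metric.mem_thickening_iff.2 ⟨x + (w - x'), ?_, ?_⟩)
    · simpa [dist_eq_norm] using hw
    · have : w - (x + (w - x')) = x' - x := by abel
      rwa [dist_eq_norm, this, ← dist_eq_norm]
  refine lt_of_le_of_lt (iSup₂_le fun z hz => hmax ?_) hwc
  simpa using hz

theorem upperSemicontinuous_lowerEnv {d : ℕ} {h : EuclideanSpace ℝ (Fin d) → ℝ≥0∞}
    (hh : UpperSemicontinuous h) (ε : ℝ) : UpperSemicontinuous (lowerEnv ε h) := by
  intro x c hc
  obtain ⟨z, hz⟩ := iInf_lt_iff.1 hc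
  obtain ⟨hzε, hz⟩ := iInf_lt_iff.1 hz
  filter_upwards [((continuous_add_const z).tendsto x).eventually (hh (x + z) c hz)] with x' hx'
  exact lt_of_le_of_lt (iInf₂_le z hzε) hx'

theorem lowerEnv_le {d : ℕ} (h : EuclideanSpace ℝ (Fin d) → ℝ≥0∞) {ε : ℝ}
    {x x' : EuclideanSpace ℝ (Fin d)} (hx : dist x' x ≤ ε) : lowerEnv ε h x ≤ h x' := by
  refine (iInf₂_le (f := fun z (_ : ‖z‖ ≤ ε) => h (x + z)) (x' - x) ?_).trans (by simp)
  rwa [← dist_eq_norm]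

theorem lowerSemicontinuous_extremalShotNoise {d : ℕ} {h : EuclideanSpace ℝ (Fin d) → ℝ≥0∞}
    (hh : LowerSemicontinuous h) (Φ : Set (EuclideanSpace ℝ (Fin d) × Set.Ioi (0 : ℝ))) :
    LowerSemicontinuous (extremalShotNoise h Φ) := by
  refine lowerSemicontinuous_iSup fun φ => lowerSemicontinuous_iSup fun _ => ?_
  refine Continuous.comp_lowerSemicontinuous
    (g := fun t : ℝ≥0∞ => ENNReal.ofReal (φ.2 : ℝ) * t)
    (ENNReal.continuous_const_mul ENNReal.ofReal_ne_top) ?_ (fun a b hab => mul_le_mul_right hab _)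
  exact hh.comp (continuous_sub_right φ.1)

theorem upperSemicontinuous_ofReal_mul_comp_sub {d : ℕ}
    {h : EuclideanSpace ℝ (Fin d) → ℝ≥0∞} (hh : UpperSemicontinuous h) (m : ℝ)
    (x : EuclideanSpace ℝ (Fin d)) :
    UpperSemicontinuous fun y => ENNReal.ofReal m * h (y - x) := by
  refine Continuous.comp_upperSemicontinuous (g := fun t : ℝ≥0∞ => ENNReal.ofReal m * t)
    (ENNReal.continuous_const_mul ENNReal.ofReal_ne_top) ?_ (fun a b hab => mul_le_mul_right hab _)
  exact hh.comp (continuous_sub_right x)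

/-- The extremal shot noise is almost surely everywhere at least `α⁻(h, G)`. -/
theorem ae_alphaMinus_le_extremalShotNoise {Ω : Type*} [MeasurableSpace Ω] {P : Measure Ω}
    {d : ℕ} {G : Measure (Set.Ioi (0 : ℝ))} [SigmaFinite G]
    {Φ : Ω → Set (EuclideanSpace ℝ (Fin d) × Set.Ioi (0 : ℝ))}
    (hΦ : IsPoissonPointProcess P ((volume : Measure (EuclideanSpace ℝ (Fin d))).prod G) Φ)
    {h : EuclideanSpace ℝ (Fin d) → ℝ≥0∞} (hh : UpperSemicontinuous h) :
    ∀ᵐ ω ∂P, ∀ y, alphaMinus h G ≤ extremalShotNoise h (Φ ω) y := by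
  obtain ⟨D, hDc, hD⟩ := TopologicalSpace.exists_countable_dense ℝ≥0∞
  obtain ⟨S, hSc, hS⟩ := TopologicalSpace.exists_countable_dense (EuclideanSpace ℝ (Fin d))
  have key : ∀ u ∈ D, ∀ᵐ ω ∂P, 0 < u → u < alphaMinus h G →
      ∀ y, u ≤ extremalShotNoise h (Φ ω) y := by
    intro u _
    by_cases hu0 : 0 < u
    swap
    · exact .of_forall fun ω h0 => absurd h0 hu0
    by_cases hu : u < alphaMinus h G
    swap
    · exact .of_forall fun ω _ h1 => absurd h1 hu
    obtain ⟨ε, hε, hεpos⟩ := (((tendsto_alphaMinus h G).eventually (lt_mem_nhds hu)).and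
      self_mem_nhdsWithin).exists
    have hmeas := (upperSemicontinuous_lowerEnv hh ε).measurable
    have hhit : ∀ s ∈ S, ∀ᵐ ω ∂P, (Φ ω ∩ exceedanceSet (lowerEnv ε h) u s).Nonempty := by
      intro s _
      refine hΦ.ae_nonempty_inter (measurableSet_exceedanceSet hmeas u s) ?_
      rw [prod_exceedanceSet hmeas hu0.ne' (hu.trans_le le_top).ne]
      exact lintegral_tailFun_eq_top_of_lt_alphaCoeff hu0 hε
    filter_upwards [(ae_ball_iff hSc).2 hhit] with ω hω _ _ y
    -- The slack `ε` in `h⁻_ε` carries the bound from the countable set `S` to every `y`, avoiding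
    -- uncountably many null sets.
    obtain ⟨s, hsS, hs⟩ := hS.exists_dist_lt y hεpos
    obtain ⟨φ, hφ, hφu⟩ := hω s hsS
    calc u ≤ ENNReal.ofReal (φ.2 : ℝ) * lowerEnv ε h (s - φ.1) := le_of_lt hφu
      _ ≤ ENNReal.ofReal (φ.2 : ℝ) * h (y - φ.1) := by
          gcongr
          exact lowerEnv_le h (by rw [dist_sub_right]; exact hs.le)
      _ ≤ extremalShotNoise h (Φ ω) y := le_iSup₂
          (f := fun (φ : EuclideanSpace ℝ (Fin d) × Set.Ioi (0 : ℝ)) (_ : φ ∈ Φ ω) =>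
            ENNReal.ofReal (φ.2 : ℝ) * h (y - φ.1)) φ hφ
  filter_upwards [(ae_ball_iff hDc).2 key] with ω hω y
  by_contra! hlt
  obtain ⟨u, huD, hu1, hu2⟩ := hD.exists_between hlt
  exact absurd (hω u huD (zero_le.trans_lt hu1) hu2 y) hu1.not_ge

/-- Almost surely, for each level `u > α⁺(h, G)` of a countable set `D`, only finitely many points
contribute values above `u` near a given location. -/
theorem ae_finite_exceedances {Ω : Type*} [MeasurableSpace Ω] {P : Measure Ω}
    {d : ℕ} {G : Measure (Set.Ioi (0 : ℝ))} [SigmaFinite G]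
    {Φ : Ω → Set (EuclideanSpace ℝ (Fin d) × Set.Ioi (0 : ℝ))}
    (hΦ : IsPoissonPointProcess P ((volume : Measure (EuclideanSpace ℝ (Fin d))).prod G) Φ)
    {h : EuclideanSpace ℝ (Fin d) → ℝ≥0∞} (hh : UpperSemicontinuous h) {D : Set ℝ≥0∞}
    (hD : D.Countable) :
    ∀ᵐ ω ∂P, ∀ u ∈ D, alphaPlus h G < u → u ≠ ∞ → ∀ y, ∃ F ⊆ Φ ω, F.Finite ∧
      ∀ᶠ y' in 𝓝 y, ∀ φ ∈ Φ ω \ F, ENNReal.ofReal (φ.2 : ℝ) * h (y' - φ.1) ≤ u := by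
  obtain ⟨S, hSc, hS⟩ := TopologicalSpace.exists_countable_dense (EuclideanSpace ℝ (Fin d))
  refine (ae_ball_iff hD).2 fun u _ => ?_
  by_cases hu : alphaPlus h G < u
  swap
  · exact .of_forall fun ω h1 => absurd h1 hu
  by_cases hut : u ≠ ∞
  swap
  · exact .of_forall fun ω _ h1 => absurd h1 hut
  have hmeas := (upperSemicontinuous_upperEnv hh).measurable
  have hfin : ∀ s ∈ S, ∀ᵐ ω ∂P, (Φ ω ∩ exceedanceSet (upperEnv h) u s).Finite := by
    intro s _
    refine hΦ.ae_finite_inter (measurableSet_exceedanceSet hmeas u s) ?_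
    rw [prod_exceedanceSet hmeas (zero_le.trans_lt hu).ne' hut]
    exact lintegral_tailFun_lt_top_of_alphaCoeff_lt hu
  filter_upwards [(ae_ball_iff hSc).2 hfin] with ω hω _ _ y
  -- The unit radius in `h⁺` lets one `s ∈ S` control all `y'` in its open unit ball, a
  -- neighbourhood of `y`.
  obtain ⟨s, hsS, hs⟩ := hS.exists_dist_lt y one_pos
  refine ⟨_, Set.inter_subset_left, hω s hsS, ?_⟩
  filter_upwards [Metric.isOpen_ball.mem_nhds hs] with y' hy' φ hφ
  have hle : ENNReal.ofReal (φ.2 : ℝ) * upperEnv h (s - φ.1) ≤ u :=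
    not_lt.1 fun hlt => hφ.2 ⟨hφ.1, hlt⟩
  refine le_trans ?_ hle
  gcongr
  exact le_upperEnv h (by rw [dist_sub_right]; exact (Metric.mem_ball.1 hy').le)

theorem ae_upperSemicontinuous_extremalShotNoise {Ω : Type*} [MeasurableSpace Ω] {P : Measure Ω}
    {d : ℕ} {G : Measure (Set.Ioi (0 : ℝ))} [SigmaFinite G]
    {Φ : Ω → Set (EuclideanSpace ℝ (Fin d) × Set.Ioi (0 : ℝ))}
    (hΦ : IsPoissonPointProcess P ((volume : Measure (EuclideanSpace ℝ (Fin d))).prod G) Φ)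
    {h : EuclideanSpace ℝ (Fin d) → ℝ≥0∞} (hα : alphaMinus h G = alphaPlus h G)
    (hh : UpperSemicontinuous h) :
    ∀ᵐ ω ∂P, UpperSemicontinuous (extremalShotNoise h (Φ ω)) := by
  obtain ⟨D, hDc, hD⟩ := TopologicalSpace.exists_countable_dense ℝ≥0∞
  filter_upwards [ae_alphaMinus_le_extremalShotNoise hΦ hh, ae_finite_exceedances hΦ hh hDc]
    with ω hlow hfin y c hc
  obtain ⟨u, huD, hu, huc⟩ := hD.exists_between hc
  -- Here `α⁺ = α⁻ ≤ M(y) < u`.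
  obtain ⟨F, hFsub, hF, hout⟩ := hfin u huD (hα ▸ (hlow y).trans_lt hu) (huc.trans_le le_top).ne y
  have hin : ∀ᶠ y' in 𝓝 y, ∀ φ ∈ F, ENNReal.ofReal (φ.2 : ℝ) * h (y' - φ.1) < u := by
    refine (eventually_all_finite hF).2 fun φ hφ => ?_
    refine upperSemicontinuous_ofReal_mul_comp_sub hh φ.2 φ.1 y u (lt_of_le_of_lt ?_ hu)
    exact le_iSup₂ (f := fun (φ : EuclideanSpace ℝ (Fin d) × Set.Ioi (0 : ℝ)) (_ : φ ∈ Φ ω) =>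
      ENNReal.ofReal (φ.2 : ℝ) * h (y - φ.1)) φ (hFsub hφ)
  filter_upwards [hin, hout] with y' hy₁ hy₂
  refine lt_of_le_of_lt (iSup₂_le fun φ hφ => ?_) huc
  by_cases hφF : φ ∈ F
  · exact (hy₁ φ hφF).le
  · exact hy₂ φ ⟨hφ, hφF⟩

theorem proposition2p6 {Ω : Type*} [MeasurableSpace Ω] (P : Measure Ω) [IsProbabilityMeasure P]
    {d : ℕ} (G : Measure (Set.Ioi (0 : ℝ)))
    (hG : ∀ u : ℝ, 0 < u → G {m | u < (m : ℝ)} < ∞)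
    (Φ : Ω → Set (EuclideanSpace ℝ (Fin d) × Set.Ioi (0 : ℝ)))
    (hΦ : IsPoissonPointProcess P ((volume : Measure (EuclideanSpace ℝ (Fin d))).prod G) Φ)
    (h : EuclideanSpace ℝ (Fin d) → ℝ≥0∞) (hh : Measurable h) :
    (LowerSemicontinuous h → ∀ ω, LowerSemicontinuous (extremalShotNoise h (Φ ω))) ∧
    (alphaMinus h G = alphaPlus h G → UpperSemicontinuous h →
      ∀ᵐ ω ∂P, UpperSemicontinuous (extremalShotNoise h (Φ ω))) ∧
    (alphaMinus h G = alphaPlus h G → Continuous h →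
      ∀ᵐ ω ∂P, Continuous (extremalShotNoise h (Φ ω))) := by
  have := sigmaFinite_of_tail_lt_top hG
  refine ⟨fun hl ω => lowerSemicontinuous_extremalShotNoise hl (Φ ω),
    fun hα hu => ae_upperSemicontinuous_extremalShotNoise hΦ hα hu, fun hα hc => ?_⟩
  filter_upwards [ae_upperSemicontinuous_extremalShotNoise hΦ hα hc.upperSemicontinuous] with ω hω
  exact continuous_iff_lower_upperSemicontinuous.2
    ⟨lowerSemicontinuous_extremalShotNoise hc.lowerSemicontinuous (Φ ω), hω⟩
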